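/- Let $k,l\ge 1$ be integers and let $G=C_{2k+1}\,\square\,C_{2l+1}$ be the Cartesian product of two odd cycles. The distance of two edges of $G$ is the minimum of the distances in $G$ between an end of the one and an end of the other. Let $E_0\subseteq E(G)$ be a set of edges any two distinct members of which are at distance at least $3$ (a distance-3 matching), and let each edge of $E_0$ be assigned one of $5$ given colors, in an arbitrary way. Then there is a proper edge coloring of $G$ with these $5$ colors in which every edge of $E_0$ has its assigned color. Moreover $\chi'(G)=5$; in particular $G$ is not $4$-edge-colorable, so the number $5$ of colors is best possible. -/

import Mathlib

/-- The distance of two edges `e` and `f`: the smallest distance between an end of `e` and an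
end of `f`. -/
noncomputable def edgeDist {V : Type*} (G : SimpleGraph V) (e f : G.edgeSet) : ℕ∞ :=
  ⨅ u ∈ (e : Sym2 V), ⨅ v ∈ (f : Sym2 V), G.edist u v

/-- A proper edge coloring of `G` with colors in `α`: distinct edges that share a vertex get
distinct colors. -/
abbrev ProperEdgeColoring {V : Type*} (G : SimpleGraph V) (α : Type*) : Type _ :=
  G.lineGraph.Coloring α

/-- The edge chromatic number (chromatic index) of `G`. -/
noncomputable def chromaticIndex {V : Type*} (G : SimpleGraph V) : ℕ∞ :=
  G.lineGraph.chromaticNumber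

/-- The prescription `p` of colors on the set `E₀` of edges extends to a proper edge coloring of
the whole graph `G` with the same set `α` of available colors. -/
def ExtendsToProper {V : Type*} (G : SimpleGraph V) {α : Type*} (E₀ : Set G.edgeSet)
    (p : E₀ → α) : Prop :=
  ∃ C : ProperEdgeColoring G α, ∀ e : E₀, C (e : G.edgeSet) = p e

/-! Color the rows of the torus alternately 0, 1 and the columns alternately 2, 3, according to the
parity of the coordinate sum, and give every wrap-around edge the color 4. This is proper except at
the four corners, which form a 4-cycle colored entirely 4; recoloring two opposite edges of it by
colors missing at their ends (`baseColor`) makes it proper. At other vertices it is the standard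
coloring, and each vertex misses a known color.

One prescribed edge is moved onto a corner edge by a translation and gets its color by a permutation
of the colors. Its closed neighborhood contains all four corners. Distance at least 3 makes the
closed neighborhoods of the prescribed edges disjoint, so around every other one the coloring is
standard (`exists_recolorable`).

There the edge can take any color by changes inside its closed neighborhood: shift a few edges at
its ends to colors missing at their far ends, possibly after interchanging two colors on a bicolored
4-cycle, or else interchange 4 and the desired color on two parallel triangles. That some move
always works depends only on the types in a 4 by 4 window, hence is a finite check
(`localCheck_eq_true`). Disjoint changes are glued by `extendsToProper_of_local`.

Four colors fail because a color class would be a perfect matching on an odd number of vertices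
(`card_even_of_proper`). -/

namespace OddTorus

/-! ### Vertex types, the standard coloring and the finite check -/

/-- A direction in the grid: an axis, and whether one moves forward along it. -/
abbrev Dir := Bool × Bool

/-- The opposite direction. -/
def op (d : Dir) : Dir := (d.1, !d.2)

/-- The type of a vertex: the position of each coordinate (`0` first, `2` last, `1` neither),
and the parity class of the vertex. -/
abbrev Ty := Fin 3 × Fin 3 × Bool

/-- The standard color of the edge leaving a vertex of type `t` in direction `d`. -/
def stdColor (t : Ty) (d : Dir) : Fin 5 :=
  match d with
  | (false, true) => if t.1 = 2 then 4 else if t.2.2 then 0 else 1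
  | (false, false) => if t.1 = 0 then 4 else if t.2.2 then 1 else 0
  | (true, true) => if t.2.1 = 2 then 4 else if t.2.2 then 2 else 3
  | (true, false) => if t.2.1 = 0 then 4 else if t.2.2 then 3 else 2

/-- The color missing at a vertex of type `t` in the standard coloring. -/
def missColor (t : Ty) : Fin 5 :=
  if t.1 = 1 then
    if t.2.1 = 1 then 4
    else if t.2.1 = 2 then (if t.2.2 then 2 else 3)
    else (if t.2.2 then 3 else 2)
  else if t.1 = 2 then (if t.2.2 then 0 else 1)
  else (if t.2.2 then 1 else 0)

/-- A coordinate of type `y` may follow a coordinate of type `x`. -/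
def follows (x y : Fin 3) : Bool := decide (x = 2 ↔ y = 0) && !(decide (x = 0) && decide (y = 2))

/-- The parity change from the second of four consecutive coordinates to each of the four. -/
def parityShift (X : Fin 4 → Fin 3) (i : Fin 4) : Bool :=
  match i with
  | 0 => decide (X 0 ≠ 2)
  | 1 => false
  | 2 => decide (X 1 ≠ 2)
  | 3 => (decide (X 1 ≠ 2)) ^^ (decide (X 2 ≠ 2))

/-- The type of the vertex at a given position of a 4 by 4 window. -/
def winTy (X Y : Fin 4 → Fin 3) (π : Bool) (p : Fin 4 × Fin 4) : Ty :=
  (X p.1, Y p.2, (π ^^ parityShift X p.1) ^^ parityShift Y p.2)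

/-- One step within a window. -/
def winStep (d : Dir) (p : Fin 4 × Fin 4) : Fin 4 × Fin 4 :=
  match d with
  | (false, true) => (p.1 + 1, p.2)
  | (false, false) => (p.1 - 1, p.2)
  | (true, true) => (p.1, p.2 + 1)
  | (true, false) => (p.1, p.2 - 1)

/-- The new colors around an endpoint with colors `s` whose neighbors miss the colors `M`, when
the edge in direction `d₀` gets the color `γ`. -/
def newColor (s M : Dir → Fin 5) (d₀ : Dir) (γ : Fin 5) (d : Dir) : Fin 5 :=
  if d = d₀ then γ
  else if s d = γ then M d
  else if ∃ d₁, d₁ ≠ d₀ ∧ s d₁ = γ ∧ M d₁ = s d then M d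
  else s d

/-- The values of `g` are pairwise distinct. -/
def distinctB (g : Dir → Fin 5) : Bool :=
  let r := g (false, true)
  let l := g (false, false)
  let u := g (true, true)
  let d := g (true, false)
  r != l && r != u && r != d && l != u && l != d && u != d

/-- The recoloring of the two endpoints of an edge is proper. -/
def starOk (su Mu sv Mv : Dir → Fin 5) (d₀ : Dir) (γ : Fin 5) (tri : Bool) : Bool :=
  let gu := newColor su Mu d₀ γ
  let gv := newColor sv Mv (op d₀) γ
  distinctB gu && distinctB gv && (!tri || gu (op d₀) != gv d₀)

/-- Recoloring only the edges at the two ends works for the edge at the centre of the window. -/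
def starCheck (T : Fin 4 × Fin 4 → Ty) (d₀ : Dir) (γ : Fin 5) (tri : Bool) : Bool :=
  let u : Fin 4 × Fin 4 := (1, 1)
  let v := winStep d₀ u
  starOk (stdColor (T u)) (fun d => missColor (T (winStep d u)))
    (stdColor (T v)) (fun d => missColor (T (winStep d v))) d₀ γ tri

/-- Recoloring works after the colors of the 4-cycle on side `dp` of the edge are interchanged. -/
def squareCheck (T : Fin 4 × Fin 4 → Ty) (d₀ dp : Dir) (γ : Fin 5) (tri : Bool) : Bool :=
  let u : Fin 4 × Fin 4 := (1, 1)
  let v := winStep d₀ u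
  let α := stdColor (T u) d₀
  let β := stdColor (T u) dp
  stdColor (T (winStep dp u)) d₀ == α && stdColor (T v) dp == β &&
  starOk (fun d => Equiv.swap α β (stdColor (T u) d)) (fun d => missColor (T (winStep d u)))
    (fun d => Equiv.swap α β (stdColor (T v) d)) (fun d => missColor (T (winStep d v))) d₀ γ tri

/-- The cycles along `dp` through the two ends are triangles, on which the colors `4` and `γ` may be
interchanged. -/
def bandCheck (X : Fin 4 → Fin 3) (T : Fin 4 × Fin 4 → Ty) (d₀ dp : Dir) (γ : Fin 5) : Bool :=
  let u : Fin 4 × Fin 4 := (1, 1)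
  let v := winStep d₀ u
  let ok := fun p => stdColor (T p) d₀ != 4 && stdColor (T p) d₀ != γ &&
    (stdColor (T p) (op d₀) != 4 && stdColor (T p) (op d₀) != γ)
  X 0 == 0 && X 2 == 2 && γ != 4 && missColor (T u) == 4 && missColor (T v) == 4 &&
  (ok u && ok (winStep dp u) && ok (winStep (op dp) u)) &&
  (ok v && ok (winStep dp v) && ok (winStep (op dp) v))

/-- One of the ways of recoloring applies to the edge along `axis` at the centre of the window. -/
def localCheck (X Y : Fin 4 → Fin 3) (π : Bool) (axis : Bool) (γ : Fin 5) : Bool :=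
  let T := winTy X Y π
  let Z := if axis then Y else X
  let W := if axis then X else Y
  let tri := Z 0 == Z 3 && !(Z 1 == 1 && Z 2 == 1)
  let d₀ : Dir := (axis, true)
  starCheck T d₀ γ tri || squareCheck T d₀ (!axis, true) γ tri ||
    squareCheck T d₀ (!axis, false) γ tri || bandCheck W T d₀ (!axis, true) γ

/-- The position is not a corner. -/
def nonCorner (t : Ty) : Bool := t.1 == 1 || t.2.1 == 1

/-- No vertex equal or adjacent to an end of the edge is a corner. -/
def ballNonCorner (T : Fin 4 × Fin 4 → Ty) (d₀ : Dir) : Bool :=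
  let u : Fin 4 × Fin 4 := (1, 1)
  let v := winStep d₀ u
  let ok := fun p => nonCorner (T (winStep (false, true) p)) &&
    nonCorner (T (winStep (false, false) p)) && nonCorner (T (winStep (true, true) p)) &&
    nonCorner (T (winStep (true, false) p))
  ok u && ok v

/-- The finite core: lengths of the cycles enter only through positions and parities near the edge,
so all tori are covered at once. Each `follows` premise stands right after its variable, which
prunes the enumeration early. -/
theorem localCheck_eq_true :
    ∀ x₁ x₀ : Fin 3, follows x₀ x₁ → ∀ x₂, follows x₁ x₂ → ∀ x₃, follows x₂ x₃ →
    ∀ y₁ y₀ : Fin 3, follows y₀ y₁ → ∀ y₂, follows y₁ y₂ → ∀ y₃, follows y₂ y₃ →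
    ∀ π axis, ballNonCorner (winTy ![x₀, x₁, x₂, x₃] ![y₀, y₁, y₂, y₃] π) (axis, true) →
    ∀ γ, localCheck ![x₀, x₁, x₂, x₃] ![y₀, y₁, y₂, y₃] π axis γ := by
  decide +kernel

/-! ### Color interchanges and recoloring in 4-regular graphs with directions -/

theorem op_op (d : Dir) : op (op d) = d := by simp [op]

theorem op_injective : Function.Injective op := fun a b h => by rw [← op_op a, h, op_op]

/-- A 4-regular simple graph whose edges have directions as in a toroidal grid. -/
structure Quad (V : Type*) where
  step : Dir → V → V
  step_op : ∀ d p, step (op d) (step d p) = p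
  step_inj : ∀ p d d', step d p = step d' p → d = d'
  step_ne : ∀ d p, step d p ≠ p

namespace Quad

variable {V α : Type*} (Q : Quad V)

/-- A proper edge coloring, given by the colors of the darts. -/
def Proper (C : V → Dir → α) : Prop :=
  (∀ p d, C (Q.step d p) (op d) = C p d) ∧ ∀ p d d', C p d = C p d' → d = d'

/-- The color `c` is missing at the vertex `p`. -/
def Missing (C : V → Dir → α) (p : V) (c : α) : Prop := ∀ d, C p d ≠ c

theorem step_op' (d : Dir) (p : V) : Q.step d (Q.step (op d) p) = p := by
  simpa [op_op] using Q.step_op (op d) p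

theorem step_left_injective (d : Dir) {p q : V} (h : Q.step d p = Q.step d q) : p = q := by
  rw [← Q.step_op d p, h, Q.step_op]

open Classical in
/-- Interchange of two colors at the vertices of a set. -/
noncomputable def kempeSwap [DecidableEq α] (C : V → Dir → α) (S : Set V) (a b : α) (p : V)
    (d : Dir) : α :=
  if p ∈ S then Equiv.swap a b (C p d) else C p d

variable {Q}

/-- An edge leaving `S` has neither of the two colors, so the interchange fixes it and both its ends
still agree on its color. -/
theorem Proper.swapped [DecidableEq α] {C : V → Dir → α} (hC : Q.Proper C) {S : Set V} {a b : α}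
    (hS : ∀ p ∈ S, ∀ d, Q.step d p ∉ S → C p d ≠ a ∧ C p d ≠ b) :
    Q.Proper (kempeSwap C S a b) := by
  classical
  constructor
  · intro p d
    unfold kempeSwap
    by_cases hp : p ∈ S <;> by_cases hq : Q.step d p ∈ S
    · simp [hp, hq, hC.1]
    · obtain ⟨h1, h2⟩ := hS p hp d hq
      simp [hp, hq, hC.1, Equiv.swap_apply_of_ne_of_ne h1 h2]
    · obtain ⟨h1, h2⟩ := hS _ hq (op d) (by rwa [Q.step_op])
      rw [hC.1] at h1 h2
      simp [hp, hq, hC.1, Equiv.swap_apply_of_ne_of_ne h1 h2]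
    · simp [hp, hq, hC.1]
  · intro p d d' h
    unfold kempeSwap at h
    split_ifs at h
    · exact hC.2 p d d' ((Equiv.swap a b).injective h)
    · exact hC.2 p d d' h

theorem kempe_eq [DecidableEq α] {C : V → Dir → α} {S : Set V} {a b : α}
    (hS : ∀ p ∈ S, ∀ d, Q.step d p ∉ S → C p d ≠ a ∧ C p d ≠ b) {p : V} {d : Dir}
    (h : kempeSwap C S a b p d ≠ C p d) : p ∈ S ∧ Q.step d p ∈ S := by
  classical
  unfold kempeSwap at h
  split_ifs at h with hp
  · refine ⟨hp, ?_⟩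
    by_contra hq
    obtain ⟨h1, h2⟩ := hS p hp d hq
    exact h (Equiv.swap_apply_of_ne_of_ne h1 h2)
  · exact absurd rfl h

/-- The colors of the edges at two adjacent vertices may be changed to `gu` and `gv` if each
changed edge gets a color missing at its far end. -/
theorem Proper.recolor {C : V → Dir → α} (hC : Q.Proper C) (u : V) (d₀ : Dir) (gu gv : Dir → α)
    (h₀ : gu d₀ = gv (op d₀))
    (iu : ∀ d d', gu d = gu d' → d = d') (iv : ∀ d d', gv d = gv d' → d = d')
    (hu : ∀ d, d ≠ d₀ → gu d = C u d ∨ Missing C (Q.step d u) (gu d))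
    (hv : ∀ d, d ≠ op d₀ → gv d = C (Q.step d₀ u) d ∨
      Missing C (Q.step d (Q.step d₀ u)) (gv d))
    (hc : ∀ d d', d ≠ d₀ → d' ≠ op d₀ → Q.step d u = Q.step d' (Q.step d₀ u) → gu d ≠ gv d') :
    ∃ C' : V → Dir → α, Q.Proper C' ∧ C' u d₀ = gu d₀ ∧
      ∀ p d, C' p d ≠ C p d →
        p = u ∨ p = Q.step d₀ u ∨ Q.step d p = u ∨ Q.step d p = Q.step d₀ u := by
  classical
  set v := Q.step d₀ u with hv_def
  have hvu : v ≠ u := Q.step_ne d₀ u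
  have hback : Q.step (op d₀) v = u := Q.step_op d₀ u
  let C' : V → Dir → α := fun p d =>
    if p = u then gu d else if p = v then gv d
    else if Q.step d p = u then gu (op d) else if Q.step d p = v then gv (op d) else C p d
  have eu : ∀ d, C' u d = gu d := fun d => by simp [C']
  have ev : ∀ d, C' v d = gv d := fun d => by simp [C', hvu]
  have e1 : ∀ p d, p ≠ u → p ≠ v → Q.step d p = u → C' p d = gu (op d) := fun p d h1 h2 h3 => by
    simp [C', h1, h2, h3]
  have e2 : ∀ p d, p ≠ u → p ≠ v → Q.step d p = v → C' p d = gv (op d) := fun p d h1 h2 h3 => by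
    simp [C', h1, h2, h3, hvu]
  have e3 : ∀ p d, p ≠ u → p ≠ v → Q.step d p ≠ u → Q.step d p ≠ v → C' p d = C p d :=
    fun p d h1 h2 h3 h4 => by simp [C', h1, h2, h3, h4]
  have sym : ∀ p d, C' (Q.step d p) (op d) = C' p d := by
    intro p d
    by_cases pu : p = u
    · subst pu
      rw [eu]
      by_cases hd : Q.step d p = v
      · have : d = d₀ := Q.step_inj _ _ _ (hd.trans hv_def)
        rw [hd, ev, this, h₀]
      · rw [e1 _ _ (Q.step_ne d p) hd (Q.step_op d p), op_op]
    by_cases pv : p = v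
    · rw [pv, ev]
      by_cases hd : Q.step d v = u
      · have : d = op d₀ := Q.step_inj v _ _ (hd.trans hback.symm)
        rw [hd, eu, this, op_op, h₀]
      · rw [e2 _ _ hd (Q.step_ne d v) (Q.step_op d v), op_op]
    by_cases hu' : Q.step d p = u
    · rw [hu', eu, e1 _ _ pu pv hu']
    by_cases hv' : Q.step d p = v
    · rw [hv', ev, e2 _ _ pu pv hv']
    rw [e3 _ _ pu pv hu' hv', e3 _ _ hu' hv' (by rwa [Q.step_op]) (by rwa [Q.step_op]), hC.1]
  have far_u : ∀ p d, p ≠ u → p ≠ v → Q.step d p = u →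
      op d ≠ d₀ ∧ (C' p d = C p d ∨ Missing C p (C' p d)) := by
    intro p d h1 h2 h3
    have hp : Q.step (op d) u = p := by rw [← h3, Q.step_op]
    have hd : op d ≠ d₀ := fun h => h2 (by rw [← hp, h])
    refine ⟨hd, ?_⟩
    rw [e1 _ _ h1 h2 h3, ← hC.1 p d, h3]
    simpa [hp] using hu (op d) hd
  have far_v : ∀ p d, p ≠ u → p ≠ v → Q.step d p = v →
      op d ≠ op d₀ ∧ (C' p d = C p d ∨ Missing C p (C' p d)) := by
    intro p d h1 h2 h3
    have hp : Q.step (op d) v = p := by rw [← h3, Q.step_op]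
    have hd : op d ≠ op d₀ := fun h => h1 (by rw [← hp, h, hback])
    refine ⟨hd, ?_⟩
    rw [e2 _ _ h1 h2 h3, ← hC.1 p d, h3]
    simpa [hp] using hv (op d) hd
  have far : ∀ p d, p ≠ u → p ≠ v → C' p d = C p d ∨
      (Missing C p (C' p d) ∧ (Q.step d p = u ∨ Q.step d p = v)) := by
    intro p d h1 h2
    by_cases hu' : Q.step d p = u
    · rcases (far_u p d h1 h2 hu').2 with h | h
      · exact Or.inl h
      · exact Or.inr ⟨h, Or.inl hu'⟩
    by_cases hv' : Q.step d p = v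
    · rcases (far_v p d h1 h2 hv').2 with h | h
      · exact Or.inl h
      · exact Or.inr ⟨h, Or.inr hv'⟩
    exact Or.inl (e3 _ _ h1 h2 hu' hv')
  -- Two changed edges can meet outside `u`, `v` only at a common neighbor of both; this is where
  -- `hc` is needed.
  have cross : ∀ p d d', p ≠ u → p ≠ v → Q.step d p = u → Q.step d' p = v → C' p d ≠ C' p d' := by
    intro p d d' h1 h2 h3 h4
    rw [e1 _ _ h1 h2 h3, e2 _ _ h1 h2 h4]
    apply hc _ _ (far_u p d h1 h2 h3).1 (far_v p d' h1 h2 h4).1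
    rw [← h3, ← h4, Q.step_op, Q.step_op]
  refine ⟨C', ⟨sym, ?_⟩, eu d₀, ?_⟩
  · intro p d d' h
    by_cases pu : p = u
    · rw [pu, eu, eu] at h
      exact iu _ _ h
    by_cases pv : p = v
    · rw [pv, ev, ev] at h
      exact iv _ _ h
    rcases far p d pu pv with h1 | ⟨h1, h1'⟩ <;> rcases far p d' pu pv with h2 | ⟨h2, h2'⟩
    · exact hC.2 p _ _ (by rw [← h1, h, h2])
    · exact absurd (by rw [← h1, h]) (h2 d)
    · exact absurd (by rw [← h2, h]) (h1 d')
    · rcases h1' with h1' | h1' <;> rcases h2' with h2' | h2'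
      · exact Q.step_inj p _ _ (h1'.trans h2'.symm)
      · exact absurd h (cross p d d' pu pv h1' h2')
      · exact absurd h.symm (cross p d' d pu pv h2' h1')
      · exact Q.step_inj p _ _ (h1'.trans h2'.symm)
  · intro p d h
    by_contra hn
    push Not at hn
    exact h (e3 p d hn.1 hn.2.1 hn.2.2.1 hn.2.2.2)

/-- An edge may get a color that is missing at both of its ends, apart from the edge itself. -/
theorem Proper.recolor_edge {C : V → Dir → α} (hC : Q.Proper C) (u : V) (d₀ : Dir) (γ : α)
    (hu : ∀ d, d ≠ d₀ → C u d ≠ γ) (hv : ∀ d, d ≠ op d₀ → C (Q.step d₀ u) d ≠ γ) :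
    ∃ C' : V → Dir → α, Q.Proper C' ∧ C' u d₀ = γ ∧
      ∀ p d, C' p d ≠ C p d →
        p = u ∨ p = Q.step d₀ u ∨ Q.step d p = u ∨ Q.step d p = Q.step d₀ u := by
  classical
  have key : ∀ (p : V) (e : Dir), (∀ d, d ≠ e → C p d ≠ γ) →
      ∀ d d', Function.update (C p) e γ d = Function.update (C p) e γ d' → d = d' := by
    intro p e h d d' hdd
    by_cases h1 : d = e <;> by_cases h2 : d' = e
    · rw [h1, h2]
    · subst h1
      simp only [Function.update_self, Function.update_of_ne h2] at hdd
      exact absurd hdd.symm (h d' h2)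
    · subst h2
      simp only [Function.update_self, Function.update_of_ne h1] at hdd
      exact absurd hdd (h d h1)
    · simp only [Function.update_of_ne h1, Function.update_of_ne h2] at hdd
      exact hC.2 p _ _ hdd
  obtain ⟨C', h1, h2, h3⟩ := hC.recolor u d₀ (Function.update (C u) d₀ γ)
    (Function.update (C (Q.step d₀ u)) (op d₀) γ) (by simp) (key u d₀ hu) (key _ _ hv)
    (fun d hd => Or.inl (Function.update_of_ne hd _ _))
    (fun d hd => Or.inl (Function.update_of_ne hd _ _))
    (by
      intro d d' hd hd' h
      rw [Function.update_of_ne hd, Function.update_of_ne hd', ← hC.1 u d,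
        ← hC.1 (Q.step d₀ u) d', h]
      intro h'
      have := op_injective (hC.2 _ _ _ h')
      subst this
      exact Q.step_ne d₀ u (Q.step_left_injective d h).symm)
  exact ⟨C', h1, by simpa using h2, h3⟩

end Quad

/-! ### The three recoloring moves -/

theorem eq_of_distinctB {g : Dir → Fin 5} (h : distinctB g = true) (d d' : Dir)
    (e : g d = g d') : d = d' := by
  simp only [distinctB, Bool.and_eq_true, bne_iff_ne, ne_eq] at h
  obtain ⟨⟨⟨⟨⟨h1, h2⟩, h3⟩, h4⟩, h5⟩, h6⟩ := h
  rcases d with ⟨_ | _, _ | _⟩ <;> rcases d' with ⟨_ | _, _ | _⟩ <;>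
    first | rfl | exact absurd e ‹_› | exact absurd e.symm ‹_›

theorem newColor_self (s M : Dir → Fin 5) (d₀ : Dir) (γ : Fin 5) : newColor s M d₀ γ d₀ = γ := by
  simp [newColor]

theorem newColor_eq (s M : Dir → Fin 5) {d₀ d : Dir} (γ : Fin 5) (h : d ≠ d₀) :
    newColor s M d₀ γ d = s d ∨ newColor s M d₀ γ d = M d := by
  unfold newColor
  rw [if_neg h]
  split
  · exact Or.inr rfl
  · split
    · exact Or.inr rfl
    · exact Or.inl rfl

theorem stdColor_ne_missColor : ∀ t : Ty, nonCorner t → ∀ d, stdColor t d ≠ missColor t := by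
  decide +kernel

theorem dir_cases (d₀ dp : Dir) (h : d₀.1 ≠ dp.1) (d : Dir) :
    d = d₀ ∨ d = op d₀ ∨ d = dp ∨ d = op dp := by
  revert d₀ dp d; decide

namespace Quad

variable {V : Type*} (Q : Quad V)

/-- The vertex `x` is an end of the edge at `u` in direction `d₀`, or adjacent to one. -/
def Ball (u : V) (d₀ : Dir) (x : V) : Prop :=
  x = u ∨ x = Q.step d₀ u ∨ (∃ d, x = Q.step d u) ∨ ∃ d, x = Q.step d (Q.step d₀ u)

/-- The coloring `C` can be changed near the edge at `u` in direction `d₀` so that this edge gets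
the color `γ`. -/
def Recolorable (C : V → Dir → Fin 5) (u : V) (d₀ : Dir) (γ : Fin 5) : Prop :=
  ∃ C' : V → Dir → Fin 5, Q.Proper C' ∧ C' u d₀ = γ ∧
    ∀ p d, C' p d ≠ C p d → Q.Ball u d₀ p ∧ Q.Ball u d₀ (Q.step d p)

variable {Q}

theorem ball_of_touch {u p : V} {d₀ d : Dir}
    (h : p = u ∨ p = Q.step d₀ u ∨ Q.step d p = u ∨ Q.step d p = Q.step d₀ u) :
    Q.Ball u d₀ p ∧ Q.Ball u d₀ (Q.step d p) := by
  rcases h with h | h | h | h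
  · exact ⟨Or.inl h, Or.inr (Or.inr (Or.inl ⟨d, by rw [h]⟩))⟩
  · exact ⟨Or.inr (Or.inl h), Or.inr (Or.inr (Or.inr ⟨d, by rw [h]⟩))⟩
  · exact ⟨Or.inr (Or.inr (Or.inl ⟨op d, by rw [← h, Q.step_op]⟩)), Or.inl h⟩
  · exact ⟨Or.inr (Or.inr (Or.inr ⟨op d, by rw [← h, Q.step_op]⟩)), Or.inr (Or.inl h)⟩

/-- A change of colors near an edge may be preceded by another one. -/
theorem Recolorable.of_change {C C₁ : V → Dir → Fin 5} {u : V} {d₀ : Dir} {γ : Fin 5}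
    (h : Q.Recolorable C₁ u d₀ γ)
    (hc : ∀ p d, C₁ p d ≠ C p d → Q.Ball u d₀ p ∧ Q.Ball u d₀ (Q.step d p)) :
    Q.Recolorable C u d₀ γ := by
  obtain ⟨C', h1, h2, h3⟩ := h
  refine ⟨C', h1, h2, fun p d hne => ?_⟩
  by_cases h' : C' p d = C₁ p d
  · exact hc p d (h' ▸ hne)
  · exact h3 p d h'

/-- `newColor` takes old colors or colors missing at far ends, as `Proper.recolor` demands. By
`hgeom` the ends have a common neighbor only when the cycle along the edge is a triangle, and then
`tri` makes the check compare the two edges there. -/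
theorem Proper.recolorable_of_starOk {C : V → Dir → Fin 5} (hC : Q.Proper C) {u : V} {d₀ : Dir}
    {γ : Fin 5} {su Mu sv Mv : Dir → Fin 5} {tri : Bool}
    (hsu : ∀ d, C u d = su d) (hsv : ∀ d, C (Q.step d₀ u) d = sv d)
    (hMu : ∀ d, Missing C (Q.step d u) (Mu d))
    (hMv : ∀ d, Missing C (Q.step d (Q.step d₀ u)) (Mv d))
    (hgeom : ∀ d d', d ≠ d₀ → d' ≠ op d₀ → Q.step d u = Q.step d' (Q.step d₀ u) →
      d = op d₀ ∧ d' = d₀ ∧ tri = true)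
    (hok : starOk su Mu sv Mv d₀ γ tri = true) : Q.Recolorable C u d₀ γ := by
  simp only [starOk, Bool.and_eq_true, Bool.or_eq_true, Bool.not_eq_true', bne_iff_ne] at hok
  obtain ⟨⟨h1, h2⟩, h3⟩ := hok
  obtain ⟨C', p1, p2, p3⟩ := hC.recolor u d₀ (newColor su Mu d₀ γ) (newColor sv Mv (op d₀) γ)
    (by rw [newColor_self, newColor_self]) (eq_of_distinctB h1) (eq_of_distinctB h2)
    (fun d hd => by
      rcases newColor_eq su Mu γ hd with h | h
      · exact Or.inl (by rw [h, hsu])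
      · exact Or.inr (by rw [h]; exact hMu d))
    (fun d hd => by
      rcases newColor_eq sv Mv γ hd with h | h
      · exact Or.inl (by rw [h, hsv])
      · exact Or.inr (by rw [h]; exact hMv d))
    (fun d d' hd hd' h => by
      obtain ⟨e1, e2, e3⟩ := hgeom d d' hd hd' h
      subst e1 e2
      rcases h3 with h3 | h3
      · rw [e3] at h3; cases h3
      · exact h3)
  exact ⟨C', p1, p2.trans (newColor_self _ _ _ _), fun p d h => ball_of_touch (p3 p d h)⟩

theorem Missing.swapped {C : V → Dir → Fin 5} {S : Set V} {a b c : Fin 5} {p : V}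
    (h : Missing C p c) (hab : p ∈ S → c ≠ a ∧ c ≠ b) : Missing (kempeSwap C S a b) p c := by
  classical
  intro d
  unfold kempeSwap
  split_ifs with hp
  · obtain ⟨h1, h2⟩ := hab hp
    intro h'
    exact h d ((Equiv.swap a b).injective (h'.trans (Equiv.swap_apply_of_ne_of_ne h1 h2).symm))
  · exact h d

/-- The square on `u`, `v` and their `dp`-neighbors is colored alternately `α`, `β`, a Kempe cycle.
Interchanging its colors gives the star move another starting point. -/
theorem Proper.recolorable_of_square {C : V → Dir → Fin 5} (hC : Q.Proper C) {u : V} {d₀ dp : Dir}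
    {γ : Fin 5} {su Mu sv Mv : Dir → Fin 5} {tri : Bool}
    (hsu : ∀ d, C u d = su d) (hsv : ∀ d, C (Q.step d₀ u) d = sv d)
    (hMu : ∀ d, Missing C (Q.step d u) (Mu d))
    (hMv : ∀ d, Missing C (Q.step d (Q.step d₀ u)) (Mv d))
    (hgeom : ∀ d d', d ≠ d₀ → d' ≠ op d₀ → Q.step d u = Q.step d' (Q.step d₀ u) →
      d = op d₀ ∧ d' = d₀ ∧ tri = true)
    (hcomm : Q.step dp (Q.step d₀ u) = Q.step d₀ (Q.step dp u))
    (hq : C (Q.step dp u) d₀ = su d₀) (hv : sv dp = su dp)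
    (hok : starOk (fun d => Equiv.swap (su d₀) (su dp) (su d)) Mu
      (fun d => Equiv.swap (su d₀) (su dp) (sv d)) Mv d₀ γ tri = true) :
    Q.Recolorable C u d₀ γ := by
  classical
  set α := su d₀ with hα
  set β := su dp with hβ
  set v := Q.step d₀ u with hvdef
  set q := Q.step dp u with hqdef
  set r := Q.step dp v with hrdef
  let S : Set V := {u, v, q, r}
  have hv1 : C v (op d₀) = α := by rw [hvdef, hC.1, hsu]
  have hv2 : C v dp = β := by rw [hsv, hv]
  have hq2 : C q (op dp) = β := by rw [hqdef, hC.1, hsu]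
  have hr1 : C r (op d₀) = α := by rw [hcomm, hC.1, hq]
  have hr2 : C r (op dp) = β := by rw [hrdef, hC.1, hv2]
  have hvu : Q.step (op d₀) v = u := Q.step_op _ _
  have hqu : Q.step (op dp) q = u := Q.step_op _ _
  have hrv : Q.step (op dp) r = v := Q.step_op _ _
  have hrq : Q.step (op d₀) r = q := by rw [hcomm, Q.step_op]
  have has : ∀ p ∈ S, ∃ d₁ d₂, C p d₁ = α ∧ C p d₂ = β ∧ Q.step d₁ p ∈ S ∧ Q.step d₂ p ∈ S := by
    rintro p (rfl | rfl | rfl | rfl)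
    · exact ⟨d₀, dp, hsu _, hsu _, by simp [S, ← hvdef], by simp [S, ← hqdef]⟩
    · exact ⟨op d₀, dp, hv1, hv2, by simp [S, hvu], by simp [S, ← hrdef]⟩
    · exact ⟨d₀, op dp, hq, hq2, by simp [S, ← hcomm], by simp [S, hqu]⟩
    · exact ⟨op d₀, op dp, hr1, hr2, by simp [S, hrq], by simp [S, hrv]⟩
  have hS : ∀ p ∈ S, ∀ d, Q.step d p ∉ S → C p d ≠ α ∧ C p d ≠ β := by
    intro p hp d hd
    obtain ⟨d₁, d₂, h1, h2, h3, h4⟩ := has p hp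
    refine ⟨fun h => hd ?_, fun h => hd ?_⟩
    · rwa [hC.2 p d d₁ (h.trans h1.symm)]
    · rwa [hC.2 p d d₂ (h.trans h2.symm)]
  -- A vertex of the square carries both `α` and `β`, so its missing colors are neither and survive
  -- the interchange.
  have hmiss : ∀ p c, Missing C p c → Missing (kempeSwap C S α β) p c := by
    intro p c h
    refine h.swapped fun hp => ?_
    obtain ⟨d₁, d₂, h1, h2, -, -⟩ := has p hp
    exact ⟨fun e => h d₁ (h1.trans e.symm), fun e => h d₂ (h2.trans e.symm)⟩
  have hball : ∀ p ∈ S, Q.Ball u d₀ p := by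
    rintro p (rfl | rfl | rfl | rfl)
    · exact Or.inl rfl
    · exact Or.inr (Or.inl rfl)
    · exact Or.inr (Or.inr (Or.inl ⟨dp, rfl⟩))
    · exact Or.inr (Or.inr (Or.inr ⟨dp, rfl⟩))
  refine Recolorable.of_change (C₁ := kempeSwap C S α β) ?_ fun p d h => ?_
  · refine (hC.swapped hS).recolorable_of_starOk (fun d => ?_) (fun d => ?_)
      (fun d => hmiss _ _ (hMu d)) (fun d => hmiss _ _ (hMv d)) hgeom hok
    · simp [kempeSwap, S, hsu]
    · simp [kempeSwap, S, hsv, ← hvdef]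
  · obtain ⟨h1, h2⟩ := kempe_eq hS h
    exact ⟨hball _ h1, hball _ h2⟩

/-- The two triangles along `dp` lie within the closed neighborhood of the edge, and all edges
across them avoid 4 and `γ`. The interchange on them turns the missing color 4 at both ends into
`γ`, which the edge can then take. -/
theorem Proper.recolorable_of_band {C : V → Dir → Fin 5} (hC : Q.Proper C) {u : V} {d₀ dp : Dir}
    {γ : Fin 5} (hax : d₀.1 ≠ dp.1)
    (hcomm : ∀ d p, Q.step d (Q.step d₀ p) = Q.step d₀ (Q.step d p))
    (htri : Q.step dp (Q.step dp u) = Q.step (op dp) u)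
    (hu : Missing C u 4) (hv : Missing C (Q.step d₀ u) 4)
    (hS : ∀ p, (p = u ∨ p = Q.step dp u ∨ p = Q.step (op dp) u ∨ p = Q.step d₀ u ∨
        p = Q.step dp (Q.step d₀ u) ∨ p = Q.step (op dp) (Q.step d₀ u)) →
      ∀ d, (d = d₀ ∨ d = op d₀) → C p d ≠ 4 ∧ C p d ≠ γ) :
    Q.Recolorable C u d₀ γ := by
  classical
  set v := Q.step d₀ u with hvdef
  have htri' : Q.step dp (Q.step dp v) = Q.step (op dp) v := by
    rw [hvdef, hcomm, hcomm, htri, hcomm]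
  let S : Set V := {p | p = u ∨ p = Q.step dp u ∨ p = Q.step (op dp) u ∨ p = v ∨
        p = Q.step dp v ∨ p = Q.step (op dp) v}
  have closed : ∀ p ∈ S, Q.step dp p ∈ S ∧ Q.step (op dp) p ∈ S := by
    have three : ∀ x, Q.step dp (Q.step dp x) = Q.step (op dp) x →
        Q.step (op dp) (Q.step (op dp) x) = Q.step dp x := fun x h => by
      rw [← h, Q.step_op]
    rintro p (rfl | rfl | rfl | rfl | rfl | rfl)
    · simp [S]
    · simp [S, htri, Q.step_op]
    · simp [S, three _ htri, Q.step_op']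
    · simp [S]
    · simp [S, htri', Q.step_op]
    · simp [S, three _ htri', Q.step_op']
  have hS' : ∀ p ∈ S, ∀ d, Q.step d p ∉ S → C p d ≠ 4 ∧ C p d ≠ γ := by
    intro p hp d hd
    rcases dir_cases d₀ dp hax d with h | h | h | h
    · exact hS p hp d (Or.inl h)
    · exact hS p hp d (Or.inr h)
    · exact absurd (h ▸ (closed p hp).1) hd
    · exact absurd (h ▸ (closed p hp).2) hd
  have hball : ∀ p ∈ S, Q.Ball u d₀ p := by
    rintro p (rfl | rfl | rfl | rfl | rfl | rfl)
    · exact Or.inl rfl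
    · exact Or.inr (Or.inr (Or.inl ⟨_, rfl⟩))
    · exact Or.inr (Or.inr (Or.inl ⟨_, rfl⟩))
    · exact Or.inr (Or.inl rfl)
    · exact Or.inr (Or.inr (Or.inr ⟨_, rfl⟩))
    · exact Or.inr (Or.inr (Or.inr ⟨_, rfl⟩))
  have key : ∀ p ∈ S, Missing C p 4 → Missing (kempeSwap C S 4 γ) p γ := by
    intro p hp h d h'
    rw [kempeSwap, if_pos hp] at h'
    exact h d ((Equiv.swap 4 γ).injective (h'.trans (Equiv.swap_apply_left 4 γ).symm))
  refine Recolorable.of_change (C₁ := kempeSwap C S 4 γ) ?_ fun p d h => ?_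
  · obtain ⟨C', h1, h2, h3⟩ := (hC.swapped hS').recolor_edge u d₀ γ
      (fun d _ => key u (by simp [S]) hu d) (fun d _ => key v (by simp [S]) hv d)
    exact ⟨C', h1, h2, fun p d h => ball_of_touch (h3 p d h)⟩
  · obtain ⟨h1, h2⟩ := kempe_eq hS' h
    exact ⟨hball _ h1, hball _ h2⟩

end Quad

/-! ### Positions and parities on an odd cycle -/

section Cycle

variable {k : ℕ}

theorem val_succ (a : Fin (2 * k + 1)) :
    (a + 1).val = if a.val = 2 * k then 0 else a.val + 1 := by
  rw [Fin.val_add_one]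
  exact if_congr Fin.ext_iff rfl rfl

theorem succ_eq_zero_iff (a : Fin (2 * k + 1)) : a + 1 = 0 ↔ a.val = 2 * k := by
  rw [Fin.ext_iff, val_succ]
  split_ifs <;> simp_all

theorem one_add_ne (hk : 1 ≤ k) (a : Fin (2 * k + 1)) : a + 1 ≠ a := by
  intro h
  have := congrArg Fin.val h
  simp only [val_succ] at this
  split_ifs at this <;> omega

theorem two_add_ne (hk : 1 ≤ k) (a : Fin (2 * k + 1)) : a + 1 + 1 ≠ a := by
  intro h
  have := congrArg Fin.val h
  simp only [val_succ] at this
  split_ifs at this <;> omega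

theorem three_add (hk : 1 ≤ k) {a : Fin (2 * k + 1)} (h : a + 1 + 1 + 1 = a) : k = 1 := by
  have := congrArg Fin.val h
  simp only [val_succ] at this
  split_ifs at this <;> omega

/-- The position of a vertex in the cycle: first, last or neither. -/
def pos (a : Fin (2 * k + 1)) : Fin 3 := if a = 0 then 0 else if a + 1 = 0 then 2 else 1

/-- The parity of the number of a vertex of the cycle. -/
def evenB (a : Fin (2 * k + 1)) : Bool := decide (a.val % 2 = 0)

theorem pos_eq_zero {a : Fin (2 * k + 1)} : pos a = 0 ↔ a = 0 := by
  unfold pos; split_ifs <;> simp_all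

theorem pos_eq_two (hk : 1 ≤ k) {a : Fin (2 * k + 1)} : pos a = 2 ↔ a + 1 = 0 := by
  unfold pos
  by_cases h : a = 0
  · subst h
    simp only [if_true]
    have := one_add_ne hk 0
    simp_all
  · rw [if_neg h]; split_ifs <;> simp_all

theorem follows_pos (hk : 1 ≤ k) (a : Fin (2 * k + 1)) : follows (pos a) (pos (a + 1)) = true := by
  simp only [follows, Bool.and_eq_true, decide_eq_true_eq, Bool.not_eq_true',
    Bool.and_eq_false_iff, decide_eq_false_iff_not, pos_eq_zero, pos_eq_two hk, true_and]
  by_contra! h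
  have := two_add_ne hk a
  rw [h.2, h.1] at this
  exact this rfl

/-- Parity alternates except across the wrap-around edge, which joins the even numbers `2 * k` and
`0`. -/
theorem evenB_succ (hk : 1 ≤ k) (a : Fin (2 * k + 1)) :
    evenB (a + 1) = (evenB a ^^ decide (pos a ≠ 2)) := by
  by_cases h : a + 1 = 0
  · have h2 := (pos_eq_two hk).2 h
    have h3 := (succ_eq_zero_iff a).1 h
    simp [evenB, h2, h, h3]
  · have h2 := (pos_eq_two hk).not.2 h
    have h3 := (succ_eq_zero_iff a).not.1 h
    simp only [evenB, val_succ, if_neg h3]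
    rcases Nat.mod_two_eq_zero_or_one a.val with e | e <;> simp [Nat.add_mod, e, h2]

/-- The positions of four consecutive vertices. -/
def posWindow (a : Fin (2 * k + 1)) : Fin 4 → Fin 3 :=
  ![pos (a - 1), pos a, pos (a + 1), pos (a + 1 + 1)]

/-- Four consecutive vertices. -/
def window (a : Fin (2 * k + 1)) : Fin 4 → Fin (2 * k + 1) := ![a - 1, a, a + 1, a + 1 + 1]

theorem pos_window (a : Fin (2 * k + 1)) (i : Fin 4) : pos (window a i) = posWindow a i := by
  fin_cases i <;> rfl

theorem evenB_window (hk : 1 ≤ k) (a : Fin (2 * k + 1)) (i : Fin 4) :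
    evenB (window a i) = (evenB a ^^ parityShift (posWindow a) i) := by
  have h0 := evenB_succ hk (a - 1)
  rw [sub_add_cancel] at h0
  have h1 := evenB_succ hk a
  have h2 := evenB_succ hk (a + 1)
  fin_cases i
  · change evenB (a - 1) = (evenB a ^^ decide (pos (a - 1) ≠ 2))
    rw [h0, Bool.xor_assoc, Bool.xor_self, Bool.xor_false]
  · exact (Bool.xor_false _).symm
  · exact h1
  · rw [h1, Bool.xor_assoc] at h2
    exact h2

end Cycle

/-! ### The torus and its windows -/

variable {k l : ℕ}

/-- The neighbor of a vertex of the torus in a given direction. -/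
def torusStep (d : Dir) (p : Fin (2 * k + 1) × Fin (2 * l + 1)) :
    Fin (2 * k + 1) × Fin (2 * l + 1) :=
  match d with
  | (false, true) => (p.1 + 1, p.2)
  | (false, false) => (p.1 - 1, p.2)
  | (true, true) => (p.1, p.2 + 1)
  | (true, false) => (p.1, p.2 - 1)

theorem sub_one_ne (hk : 1 ≤ k) (a : Fin (2 * k + 1)) : a - 1 ≠ a := fun h =>
  one_add_ne hk a (by nth_rewrite 1 [← h]; simp)

theorem add_one_ne_sub_one (hk : 1 ≤ k) (a : Fin (2 * k + 1)) : a + 1 ≠ a - 1 := fun h =>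
  two_add_ne hk a (by rw [h]; simp)

/-- The Cartesian product of two odd cycles. -/
def torus (hk : 1 ≤ k) (hl : 1 ≤ l) : Quad (Fin (2 * k + 1) × Fin (2 * l + 1)) where
  step := torusStep
  step_op := by
    rintro ⟨_ | _, _ | _⟩ ⟨a, b⟩ <;> simp [op, torusStep]
  step_ne := by
    rintro ⟨_ | _, _ | _⟩ ⟨a, b⟩ <;>
      simp [torusStep, one_add_ne, sub_one_ne, hk, hl, -add_eq_left, -sub_eq_self]
  step_inj := by
    have h1 := one_add_ne hk
    have h2 := one_add_ne hl
    have h3 := sub_one_ne hk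
    have h4 := sub_one_ne hl
    have h5 := add_one_ne_sub_one hk
    have h6 := add_one_ne_sub_one hl
    rintro ⟨a, b⟩ ⟨_ | _, _ | _⟩ ⟨_ | _, _ | _⟩ h <;> first
      | rfl
      | (simp only [torusStep, Prod.mk.injEq] at h
         first
          | exact absurd h.1 (h1 _) | exact absurd h.1 (h3 _) | exact absurd h.1 (h5 _)
          | exact absurd h.1.symm (h1 _) | exact absurd h.1.symm (h3 _)
          | exact absurd h.1.symm (h5 _)
          | exact absurd h.2 (h6 _) | exact absurd h.2.symm (h6 _))

/-- The type of a vertex of the torus. -/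
def ty (p : Fin (2 * k + 1) × Fin (2 * l + 1)) : Ty :=
  (pos p.1, pos p.2, !(evenB p.1 ^^ evenB p.2))

/-- The 4 by 4 window at a vertex of the torus. -/
def emb (u : Fin (2 * k + 1) × Fin (2 * l + 1)) (i : Fin 4 × Fin 4) :
    Fin (2 * k + 1) × Fin (2 * l + 1) :=
  (window u.1 i.1, window u.2 i.2)

/-- The types of the vertices in a window. -/
def tyWindow (u : Fin (2 * k + 1) × Fin (2 * l + 1)) : Fin 4 × Fin 4 → Ty :=
  winTy (posWindow u.1) (posWindow u.2) (ty u).2.2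

theorem ty_emb (hk : 1 ≤ k) (hl : 1 ≤ l) (u : Fin (2 * k + 1) × Fin (2 * l + 1))
    (i : Fin 4 × Fin 4) : ty (emb u i) = tyWindow u i := by
  simp only [ty, emb, tyWindow, winTy, pos_window, evenB_window hk, evenB_window hl,
    Prod.mk.injEq, true_and]
  generalize evenB u.1 = a, evenB u.2 = b, parityShift _ _ = c, parityShift _ _ = d
  revert a b c d
  decide

theorem torusStep_emb_center (u : Fin (2 * k + 1) × Fin (2 * l + 1)) (d : Dir) :
    torusStep d u = emb u (winStep d (1, 1)) := by
  rcases d with ⟨_ | _, _ | _⟩ <;> rfl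

theorem torusStep_emb (u : Fin (2 * k + 1) × Fin (2 * l + 1)) (axis : Bool) (d : Dir) :
    torusStep d (torusStep (axis, true) u) = emb u (winStep d (winStep (axis, true) (1, 1))) := by
  rcases axis with _ | _ <;> rcases d with ⟨_ | _, _ | _⟩ <;>
    simp [torusStep, emb, winStep, window]

theorem localCheck_window (hk : 1 ≤ k) (hl : 1 ≤ l) (u : Fin (2 * k + 1) × Fin (2 * l + 1))
    (axis : Bool) (γ : Fin 5) (h : ballNonCorner (tyWindow u) (axis, true) = true) :
    localCheck (posWindow u.1) (posWindow u.2) (ty u).2.2 axis γ = true := by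
  have f1 := follows_pos hk (u.1 - 1)
  have f2 := follows_pos hl (u.2 - 1)
  rw [sub_add_cancel] at f1 f2
  exact localCheck_eq_true _ _ f1 _ (follows_pos hk _) _ (follows_pos hk _) _ _ f2 _
    (follows_pos hl _) _ (follows_pos hl _) _ axis h γ

theorem torusStep_comm (d d' : Dir) (p : Fin (2 * k + 1) × Fin (2 * l + 1)) :
    torusStep d (torusStep d' p) = torusStep d' (torusStep d p) := by
  rcases d with ⟨_ | _, _ | _⟩ <;> rcases d' with ⟨_ | _, _ | _⟩ <;>
    simp [torusStep]

/-- In a triangle the outer entries of the window are the same vertex, and the middle position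
occurs once. The test may also succeed on longer cycles, which only makes the check stricter. -/
theorem posWindow_triangle (hk : 1 ≤ k) {a : Fin (2 * k + 1)} (h : a - 1 = a + 1 + 1) :
    (posWindow a 0 == posWindow a 3 && !(posWindow a 1 == 1 && posWindow a 2 == 1)) = true := by
  have h3 : a + 1 + 1 + 1 = a := by rw [← h, sub_add_cancel]
  obtain rfl := three_add hk h3
  revert a
  decide

variable {k l : ℕ}

/-- Transfers the finite check to the torus: without corners nearby, all colors and missing colors
involved can be read off the window. -/
theorem recolorable_of_nonCorner (hk : 1 ≤ k) (hl : 1 ≤ l)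
    {C : Fin (2 * k + 1) × Fin (2 * l + 1) → Dir → Fin 5} (hC : (torus hk hl).Proper C)
    (hstd : ∀ p, nonCorner (ty p) = true → ∀ d, C p d = stdColor (ty p) d)
    (u : Fin (2 * k + 1) × Fin (2 * l + 1)) (axis : Bool)
    (hball : ∀ x, (torus hk hl).Ball u (axis, true) x → nonCorner (ty x) = true) (γ : Fin 5) :
    (torus hk hl).Recolorable C u (axis, true) γ := by
  have hT1 : ∀ d, ty ((torus hk hl).step d u) = tyWindow u (winStep d (1, 1)) := fun d => by
    rw [← ty_emb hk hl, ← torusStep_emb_center]; rfl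
  have hT2 : ∀ d, ty ((torus hk hl).step d ((torus hk hl).step (axis, true) u)) =
      tyWindow u (winStep d (winStep (axis, true) (1, 1))) := fun d => by
    rw [← ty_emb hk hl, ← torusStep_emb]; rfl
  have hT0 : ty u = tyWindow u (1, 1) := by rw [← ty_emb hk hl]; rfl
  have hbu : nonCorner (ty u) = true := hball _ (Or.inl rfl)
  have hbv : nonCorner (ty ((torus hk hl).step (axis, true) u)) = true :=
    hball _ (Or.inr (Or.inl rfl))
  have hbu' : ∀ d, nonCorner (ty ((torus hk hl).step d u)) = true := fun d =>
    hball _ (Or.inr (Or.inr (Or.inl ⟨d, rfl⟩)))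
  have hbv' : ∀ d, nonCorner (ty ((torus hk hl).step d ((torus hk hl).step (axis, true) u))) =
      true := fun d => hball _ (Or.inr (Or.inr (Or.inr ⟨d, rfl⟩)))
  have hsu : ∀ d, C u d = stdColor (tyWindow u (1, 1)) d := fun d => by rw [hstd u hbu, hT0]
  have hsv : ∀ d, C ((torus hk hl).step (axis, true) u) d =
      stdColor (tyWindow u (winStep (axis, true) (1, 1))) d := fun d => by
    rw [hstd _ hbv, hT1]
  have hsu' : ∀ d' d, C ((torus hk hl).step d' u) d =
      stdColor (tyWindow u (winStep d' (1, 1))) d := fun d' d => by rw [hstd _ (hbu' d'), hT1]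
  have hsv' : ∀ d' d, C ((torus hk hl).step d' ((torus hk hl).step (axis, true) u)) d =
      stdColor (tyWindow u (winStep d' (winStep (axis, true) (1, 1)))) d := fun d' d => by
    rw [hstd _ (hbv' d'), hT2]
  have miss : ∀ p, nonCorner (ty p) = true → Quad.Missing C p (missColor (ty p)) :=
    fun p hp d => by rw [hstd p hp]; exact stdColor_ne_missColor _ hp d
  have hMu : ∀ d, Quad.Missing C ((torus hk hl).step d u)
      (missColor (tyWindow u (winStep d (1, 1)))) := fun d => by
    rw [← hT1]; exact miss _ (hbu' d)
  have hMv : ∀ d, Quad.Missing C ((torus hk hl).step d ((torus hk hl).step (axis, true) u))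
      (missColor (tyWindow u (winStep d (winStep (axis, true) (1, 1))))) := fun d => by
    rw [← hT2]; exact miss _ (hbv' d)
  have hcomm : ∀ d d' p, (torus hk hl).step d ((torus hk hl).step d' p) =
      (torus hk hl).step d' ((torus hk hl).step d p) := torusStep_comm
  have hwin : ballNonCorner (tyWindow u) (axis, true) = true := by
    simp only [ballNonCorner, ← hT1, ← hT2, hbu', hbv', Bool.and_self]
  have hgeom : ∀ d d', d ≠ (axis, true) → d' ≠ op (axis, true) →
      (torus hk hl).step d u = (torus hk hl).step d' ((torus hk hl).step (axis, true) u) →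
      d = op (axis, true) ∧ d' = (axis, true) ∧
      ((if axis then posWindow u.2 else posWindow u.1) 0 ==
          (if axis then posWindow u.2 else posWindow u.1) 3 &&
        !((if axis then posWindow u.2 else posWindow u.1) 1 == 1 &&
          (if axis then posWindow u.2 else posWindow u.1) 2 == 1)) = true := by
    have h1 := one_add_ne hk u.1
    have h2 := one_add_ne hl u.2
    have h3 := fun h => posWindow_triangle hk (a := u.1) h
    have h4 := fun h => posWindow_triangle hl (a := u.2) h
    have h5 := sub_one_ne hk u.1
    have h6 := sub_one_ne hl u.2
    have h7 := one_add_ne hk (u.1 + 1)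
    have h8 := one_add_ne hl (u.2 + 1)
    have h9 := add_one_ne_sub_one hk u.1
    have h10 := add_one_ne_sub_one hl u.2
    intro d d' hd hd' h
    change torusStep d u = torusStep d' (torusStep (axis, true) u) at h
    rcases axis with _ | _
    · rcases d with ⟨_ | _, _ | _⟩ <;> rcases d' with ⟨_ | _, _ | _⟩ <;>
        simp only [torusStep, Prod.mk.injEq] at h <;>
        first
          | exact ⟨rfl, rfl, h3 h.1⟩
          | exact absurd rfl hd
          | exact absurd rfl hd'
          | exact absurd h.1.symm h1
          | exact absurd h.2 h2
          | exact absurd h.2.symm h2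
          | exact absurd h.2 h6
          | exact absurd h.2.symm h6
    · rcases d with ⟨_ | _, _ | _⟩ <;> rcases d' with ⟨_ | _, _ | _⟩ <;>
        simp only [torusStep, Prod.mk.injEq] at h <;>
        first
          | exact ⟨rfl, rfl, h4 h.2⟩
          | exact absurd rfl hd
          | exact absurd rfl hd'
          | exact absurd h.2.symm h2
          | exact absurd h.1 h1
          | exact absurd h.1.symm h1
          | exact absurd h.1 h5
          | exact absurd h.1.symm h5
  have hcheck := localCheck_window hk hl u axis γ hwin
  change (starCheck (tyWindow u) (axis, true) γ _ ||
    squareCheck (tyWindow u) (axis, true) (!axis, true) γ _ ||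
    squareCheck (tyWindow u) (axis, true) (!axis, false) γ _ ||
    bandCheck (if axis then posWindow u.1 else posWindow u.2) (tyWindow u) (axis, true)
      (!axis, true) γ) = true at hcheck
  simp only [Bool.or_eq_true] at hcheck
  have square : ∀ dp, squareCheck (tyWindow u) (axis, true) dp γ
      ((if axis then posWindow u.2 else posWindow u.1) 0 ==
          (if axis then posWindow u.2 else posWindow u.1) 3 &&
        !((if axis then posWindow u.2 else posWindow u.1) 1 == 1 &&
          (if axis then posWindow u.2 else posWindow u.1) 2 == 1)) = true →
      (torus hk hl).Recolorable C u (axis, true) γ := by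
    intro dp h
    simp only [squareCheck, Bool.and_eq_true, beq_iff_eq] at h
    exact hC.recolorable_of_square hsu hsv hMu hMv hgeom (hcomm _ _ _)
      ((hsu' dp _).trans h.1.1) h.1.2 h.2
  rcases hcheck with ((h | h) | h) | h
  · exact hC.recolorable_of_starOk hsu hsv hMu hMv hgeom h
  · exact square _ h
  · exact square _ h
  · simp only [bandCheck, Bool.and_eq_true, beq_iff_eq, bne_iff_ne] at h
    obtain ⟨⟨⟨⟨⟨⟨hX0, hX2⟩, -⟩, hmu⟩, hmv⟩, hu⟩, hv⟩ := h
    refine hC.recolorable_of_band (dp := (!axis, true)) (by simp) (fun d p => hcomm _ _ _) ?_ ?_ ?_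
      ?_
    · rcases axis with _ | _
      · have e0 : u.2 - 1 = 0 := pos_eq_zero.1 hX0
        have e2 : u.2 + 1 + 1 = 0 := (pos_eq_two hl).1 hX2
        change (u.1, u.2 + 1 + 1) = (u.1, u.2 - 1)
        rw [e0, e2]
      · have e0 : u.1 - 1 = 0 := pos_eq_zero.1 hX0
        have e2 : u.1 + 1 + 1 = 0 := (pos_eq_two hk).1 hX2
        change (u.1 + 1 + 1, u.2) = (u.1 - 1, u.2)
        rw [e0, e2]
    · have := miss u hbu
      rwa [hT0, hmu] at this
    · have := miss _ hbv
      rwa [hT1, hmv] at this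
    · rintro p (rfl | rfl | rfl | rfl | rfl | rfl) d hd
      · rw [hsu]; rcases hd with rfl | rfl
        exacts [hu.1.1.1, hu.1.1.2]
      · rw [hsu']; rcases hd with rfl | rfl
        exacts [hu.1.2.1, hu.1.2.2]
      · rw [hsu']; rcases hd with rfl | rfl
        exacts [hu.2.1, hu.2.2]
      · rw [hsv]; rcases hd with rfl | rfl
        exacts [hv.1.1.1, hv.1.1.2]
      · rw [hsv']; rcases hd with rfl | rfl
        exacts [hv.1.2.1, hv.1.2.2]
      · rw [hsv']; rcases hd with rfl | rfl
        exacts [hv.2.1, hv.2.2]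

/-! ### The proper base coloring, translations and color permutations -/

/-- The standard coloring, adapted at the four corners so that it is proper there and the corner
edges along `axis` keep the color `4`. -/
def baseColor (axis : Bool) (t : Ty) (d : Dir) : Fin 5 :=
  if !nonCorner t && stdColor t d == 4 && d.1 != axis then
    if axis then (if t.2.1 = 2 then 2 else 3) else (if t.1 = 2 then 0 else 1)
  else stdColor t d

theorem baseColor_horizontal : ∀ axis, ∀ x x', follows x x' → ∀ y π,
    baseColor axis (x', y, (π ^^ decide (x ≠ 2))) (false, false) =
      baseColor axis (x, y, π) (false, true) := by decide +kernel

theorem baseColor_vertical : ∀ axis, ∀ y y', follows y y' → ∀ x π,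
    baseColor axis (x, y', (π ^^ decide (y ≠ 2))) (true, false) =
      baseColor axis (x, y, π) (true, true) := by decide +kernel

/-- Odd corner types are excluded: they do not occur, since `0` and `2 * k` are even. -/
theorem baseColor_injective : ∀ axis, ∀ t : Ty, (nonCorner t || t.2.2) = true →
    ∀ d d', baseColor axis t d = baseColor axis t d' → d = d' := by decide +kernel

theorem evenB_of_pos (hk : 1 ≤ k) {a : Fin (2 * k + 1)} (h : pos a ≠ 1) : evenB a = true := by
  by_cases h0 : pos a = 0
  · rw [pos_eq_zero.1 h0]; simp [evenB]
  · have h2 : pos a = 2 := by omega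
    rw [pos_eq_two hk, succ_eq_zero_iff] at h2
    simp [evenB, h2]

theorem nonCorner_or (hk : 1 ≤ k) (hl : 1 ≤ l) (p : Fin (2 * k + 1) × Fin (2 * l + 1)) :
    (nonCorner (ty p) || (ty p).2.2) = true := by
  by_cases h1 : pos p.1 = 1
  · simp [nonCorner, ty, h1]
  by_cases h2 : pos p.2 = 1
  · simp [nonCorner, ty, h2]
  · simp [ty, evenB_of_pos hk h1, evenB_of_pos hl h2]

theorem ty_right (hk : 1 ≤ k) (p : Fin (2 * k + 1) × Fin (2 * l + 1)) :
    ty (p.1 + 1, p.2) = (pos (p.1 + 1), pos p.2, ((ty p).2.2 ^^ decide (pos p.1 ≠ 2))) := by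
  simp only [ty, evenB_succ hk, Prod.mk.injEq, true_and]
  generalize evenB p.1 = a, evenB p.2 = b, decide (pos p.1 ≠ 2) = c
  revert a b c; decide

theorem ty_up (hl : 1 ≤ l) (p : Fin (2 * k + 1) × Fin (2 * l + 1)) :
    ty (p.1, p.2 + 1) = (pos p.1, pos (p.2 + 1), ((ty p).2.2 ^^ decide (pos p.2 ≠ 2))) := by
  simp only [ty, evenB_succ hl, Prod.mk.injEq, true_and]
  generalize evenB p.1 = a, evenB p.2 = b, decide (pos p.2 ≠ 2) = c
  revert a b c; decide

theorem proper_baseColor (hk : 1 ≤ k) (hl : 1 ≤ l) (axis : Bool) :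
    (torus hk hl).Proper fun p d => baseColor axis (ty p) d := by
  have right : ∀ p : Fin (2 * k + 1) × Fin (2 * l + 1),
      baseColor axis (ty (p.1 + 1, p.2)) (false, false) = baseColor axis (ty p) (false, true) :=
    fun p => by
      rw [ty_right hk]
      exact baseColor_horizontal axis _ _ (follows_pos hk _) _ _
  have up : ∀ p : Fin (2 * k + 1) × Fin (2 * l + 1),
      baseColor axis (ty (p.1, p.2 + 1)) (true, false) = baseColor axis (ty p) (true, true) :=
    fun p => by
      rw [ty_up hl]
      exact baseColor_vertical axis _ _ (follows_pos hl _) _ _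
  refine ⟨?_, fun p => baseColor_injective axis _ (nonCorner_or hk hl p)⟩
  rintro p ⟨_ | _, _ | _⟩
  · have := right (p.1 - 1, p.2)
    simp only [sub_add_cancel] at this
    exact this.symm
  · exact right p
  · have := up (p.1, p.2 - 1)
    simp only [sub_add_cancel] at this
    exact this.symm
  · exact up p

theorem torusStep_sub (d : Dir) (p τ : Fin (2 * k + 1) × Fin (2 * l + 1)) :
    torusStep d (p - τ) = torusStep d p - τ := by
  rcases d with ⟨_ | _, _ | _⟩ <;> simp only [torusStep, Prod.ext_iff, Prod.fst_sub, Prod.snd_sub]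
  · exact ⟨sub_right_comm _ _ _, trivial⟩
  · exact ⟨sub_add_eq_add_sub _ _ _, trivial⟩
  · exact ⟨trivial, sub_right_comm _ _ _⟩
  · exact ⟨trivial, sub_add_eq_add_sub _ _ _⟩

theorem Quad.Proper.translate {α : Type*} {hk : 1 ≤ k} {hl : 1 ≤ l}
    {C : Fin (2 * k + 1) × Fin (2 * l + 1) → Dir → α}
    (hC : (torus hk hl).Proper C) (τ : Fin (2 * k + 1) × Fin (2 * l + 1)) :
    (torus hk hl).Proper fun p d => C (p - τ) d := by
  refine ⟨fun p d => ?_, fun p => hC.2 _⟩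
  have := hC.1 (p - τ) d
  rwa [show (torus hk hl).step d (p - τ) = (torus hk hl).step d p - τ from torusStep_sub d p τ]
    at this

theorem ball_sub {hk : 1 ≤ k} {hl : 1 ≤ l} {u x τ : Fin (2 * k + 1) × Fin (2 * l + 1)} {d₀ : Dir} :
    (torus hk hl).Ball (u - τ) d₀ (x - τ) ↔ (torus hk hl).Ball u d₀ x := by
  have h : ∀ d p, (torus hk hl).step d (p - τ) = (torus hk hl).step d p - τ :=
    fun d p => torusStep_sub d p τ
  simp only [Quad.Ball, h, sub_left_inj]

theorem eq_neg_one_or_zero {hk : 1 ≤ k} {a : Fin (2 * k + 1)} (h : pos a ≠ 1) :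
    a = 0 ∨ a = 0 - 1 := by
  by_cases h0 : pos a = 0
  · exact Or.inl (pos_eq_zero.1 h0)
  · have h2 : pos a = 2 := by omega
    exact Or.inr (eq_sub_of_add_eq ((pos_eq_two hk).1 h2))

/-- The corners form a 4-cycle containing the edge that ends at `0`, so each is an end of that edge
or adjacent to one. -/
theorem ball_of_corner (hk : 1 ≤ k) (hl : 1 ≤ l) (axis : Bool)
    {x : Fin (2 * k + 1) × Fin (2 * l + 1)} (h : nonCorner (ty x) ≠ true) :
    (torus hk hl).Ball (torusStep (axis, false) 0) (axis, true) x := by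
  simp only [nonCorner, ty, ne_eq, Bool.or_eq_true, beq_iff_eq, not_or] at h
  have hv : (torus hk hl).step (axis, true) (torusStep (axis, false) 0) = 0 :=
    (torus hk hl).step_op (axis, false) 0
  rw [Quad.Ball, hv]
  obtain ⟨a, b⟩ := x
  rcases eq_neg_one_or_zero (hk := hk) h.1 with rfl | rfl <;>
    rcases eq_neg_one_or_zero (hk := hl) h.2 with rfl | rfl
  · exact Or.inr (Or.inl rfl)
  · exact Or.inr (Or.inr (Or.inr ⟨(true, false), rfl⟩))
  · exact Or.inr (Or.inr (Or.inr ⟨(false, false), rfl⟩))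
  · rcases axis with _ | _
    · exact Or.inr (Or.inr (Or.inl ⟨(true, false), rfl⟩))
    · exact Or.inr (Or.inr (Or.inl ⟨(false, false), rfl⟩))

theorem Quad.Proper.comp {V α β : Type*} {Q : Quad V} {C : V → Dir → α} (hC : Q.Proper C)
    {f : α → β} (hf : Function.Injective f) : Q.Proper fun p d => f (C p d) :=
  ⟨fun p d => congrArg f (hC.1 p d), fun p d d' h => hC.2 p d d' (hf h)⟩

theorem baseColor_corner (hk : 1 ≤ k) (hl : 1 ≤ l) (axis : Bool) :
    baseColor axis (ty (torusStep (axis, false) (0 : Fin (2 * k + 1) × Fin (2 * l + 1))))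
      (axis, true) = 4 := by
  have h1 : pos (0 - 1 : Fin (2 * k + 1)) = 2 := (pos_eq_two hk).2 (by simp)
  have h2 : pos (0 - 1 : Fin (2 * l + 1)) = 2 := (pos_eq_two hl).2 (by simp)
  rcases axis with _ | _
  · simp [torusStep, ty, baseColor, stdColor, h1, -zero_sub]
  · simp [torusStep, ty, baseColor, stdColor, h2, -zero_sub]

/-- Any edge is in a proper coloring that gives it a prescribed color and can be changed near each
edge far from it. -/
theorem exists_recolorable (hk : 1 ≤ k) (hl : 1 ≤ l)
    (u₀ : Fin (2 * k + 1) × Fin (2 * l + 1)) (axis₀ : Bool) (γ₀ : Fin 5) :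
    ∃ C, (torus hk hl).Proper C ∧ C u₀ (axis₀, true) = γ₀ ∧ ∀ u axis,
      (∀ x, (torus hk hl).Ball u (axis, true) x → ¬ (torus hk hl).Ball u₀ (axis₀, true) x) →
      ∀ γ, (torus hk hl).Recolorable C u (axis, true) γ := by
  -- Translating by the head of the edge puts the head at `0`, so the edge becomes a corner edge, of
  -- color 4.
  set τ := torusStep (axis₀, true) u₀ with hτ
  have hu₀ : u₀ - τ = torusStep (axis₀, false) 0 := by
    rw [← sub_self τ, torusStep_sub, hτ]
    congr 1
    exact ((torus hk hl).step_op (axis₀, true) u₀).symm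
  let σ := Equiv.swap 4 γ₀
  have hB := proper_baseColor hk hl axis₀
  refine ⟨fun p d => σ (baseColor axis₀ (ty (p - τ)) d),
    (hB.translate τ).comp σ.injective, ?_, fun u axis hfar γ => ?_⟩
  · change σ (baseColor axis₀ (ty (u₀ - τ)) (axis₀, true)) = γ₀
    rw [hu₀, baseColor_corner hk hl]
    exact Equiv.swap_apply_left _ _
  -- The recoloring takes place before `σ` is applied, hence the target `σ.symm γ`.
  · obtain ⟨C', h1, h2, h3⟩ := recolorable_of_nonCorner hk hl hB (fun p hp d => by
        simp [baseColor, hp]) (u - τ) axis (fun x hx => by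
          by_contra hn
          have := ball_of_corner hk hl axis₀ hn
          rw [← hu₀, ← add_sub_cancel_right x τ, ball_sub] at this
          rw [← add_sub_cancel_right x τ, ball_sub] at hx
          exact hfar _ hx this) (σ.symm γ)
    refine ⟨fun p d => σ (C' (p - τ) d), (h1.translate τ).comp σ.injective, ?_, fun p d hne => ?_⟩
    · change σ (C' (u - τ) (axis, true)) = γ
      rw [h2, Equiv.apply_symm_apply]
    · have := h3 (p - τ) d fun h => hne (congrArg σ h)
      rw [show (torus hk hl).step d (p - τ) = (torus hk hl).step d p - τ from torusStep_sub d p τ,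
        ball_sub, ball_sub] at this
      exact this

/-! ### Gluing local changes -/

section Gluing

variable {V α : Type*} (G : SimpleGraph V)

/-- A function on pairs of vertices whose restriction to the edges is a proper edge coloring. -/
def EdgeProper (K : Sym2 V → α) : Prop :=
  ∀ p q r, G.Adj p q → G.Adj p r → K s(p, q) = K s(p, r) → q = r

/-- The vertex `x` is an end of the edge `e`, or adjacent to one. -/
def Near (e : Sym2 V) (x : V) : Prop := ∃ y ∈ e, x = y ∨ G.Adj y x

variable {G}

/-- The proper edge coloring given by a function on pairs of vertices. -/
def EdgeProper.coloring {K : Sym2 V → α} (hK : EdgeProper G K) : ProperEdgeColoring G α :=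
  SimpleGraph.Coloring.mk (fun e => K e) fun {e f} h => by
    obtain ⟨hne, x, hx⟩ := SimpleGraph.lineGraph_adj_iff_exists.1 h
    obtain ⟨q, hq⟩ := hx.1
    obtain ⟨r, hr⟩ := hx.2
    intro heq
    have h1 : G.Adj x q := by have := e.2; rwa [hq] at this
    have h2 : G.Adj x r := by have := f.2; rwa [hr] at this
    simp only [hq, hr] at heq
    exact hne (Subtype.ext (by rw [hq, hr, hK x q r h1 h2 heq]))

/-- Contrapositive use: edges at distance at least 3 have disjoint closed neighborhoods. -/
theorem edgeDist_le_two {e f : G.edgeSet} {x : V} (he : Near G e x) (hf : Near G f x) :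
    edgeDist G e f ≤ 2 := by
  obtain ⟨y, hy, hyx⟩ := he
  obtain ⟨z, hz, hzx⟩ := hf
  have key : ∀ y : V, (x = y ∨ G.Adj y x) → G.edist y x ≤ 1 := by
    rintro y (rfl | h)
    · simp
    · exact (SimpleGraph.edist_eq_one_iff_adj.2 h).le
  calc edgeDist G e f ≤ G.edist y z := by
        unfold edgeDist
        exact (iInf₂_le y hy).trans (iInf₂_le z hz)
    _ ≤ G.edist y x + G.edist x z := SimpleGraph.edist_triangle
    _ ≤ 1 + 1 := add_le_add (key y hyx) (by rw [SimpleGraph.edist_comm]; exact key z hzx)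
    _ = 2 := one_add_one_eq_two

/-- Changes of a proper edge coloring near edges that are far apart can be made simultaneously. -/
theorem extendsToProper_of_local {E₀ : Set G.edgeSet} {p : E₀ → α} {K₀ : Sym2 V → α}
    (hK₀ : EdgeProper G K₀)
    (hsep : ∀ e ∈ E₀, ∀ f ∈ E₀, e ≠ f → ∀ x, Near G e x → ¬ Near G f x)
    (hloc : ∀ e : E₀, ∃ K : Sym2 V → α, EdgeProper G K ∧ K (e : G.edgeSet) = p e ∧
      ∀ q r, G.Adj q r → ¬ (Near G (e : G.edgeSet) q ∧ Near G (e : G.edgeSet) r) →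
        K s(q, r) = K₀ s(q, r)) : ExtendsToProper G E₀ p := by
  classical
  choose K hK hKe hKloc using hloc
  let In : Sym2 V → E₀ → Prop := fun s e => ∀ x ∈ s, Near G (e : G.edgeSet) x
  have uniq : ∀ (e f : E₀) x, Near G (e : G.edgeSet) x → Near G (f : G.edgeSet) x → e = f := by
    intro e f x he hf
    by_contra hne
    exact hsep e e.2 f f.2 (fun h => hne (Subtype.ext h)) x he hf
  let L : Sym2 V → α := fun s => if h : ∃ e, In s e then K h.choose s else K₀ s
  -- Properness is a condition at each vertex: near `e` the glued function agrees with `K e` on all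
  -- edges at the vertex, elsewhere with `K₀`. An edge with only one end near `e` has the same color
  -- in both.
  have L_near : ∀ (e : E₀) x y, Near G (e : G.edgeSet) x → G.Adj x y → L s(x, y) = K e s(x, y) := by
    intro e x y hx hxy
    by_cases h : ∃ f, In s(x, y) f
    · have : h.choose = e := uniq _ _ x (h.choose_spec x (by simp)) hx
      simp only [L, dif_pos h, this]
    · simp only [L, dif_neg h]
      refine (hKloc e x y hxy fun h' => h ⟨e, ?_⟩).symm
      intro z hz
      rcases Sym2.mem_iff.1 hz with rfl | rfl
      exacts [h'.1, h'.2]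
  have L_far : ∀ x y, (∀ e : E₀, ¬ Near G (e : G.edgeSet) x) → L s(x, y) = K₀ s(x, y) := by
    intro x y hx
    have h : ¬ ∃ f, In s(x, y) f := fun ⟨f, hf⟩ => hx f (hf x (by simp))
    simp only [L, dif_neg h]
  have hL : EdgeProper G L := by
    intro x q r hq hr h
    by_cases hx : ∃ e : E₀, Near G (e : G.edgeSet) x
    · obtain ⟨e, he⟩ := hx
      rw [L_near e x q he hq, L_near e x r he hr] at h
      exact hK e x q r hq hr h
    · push Not at hx
      rw [L_far x q hx, L_far x r hx] at h
      exact hK₀ x q r hq hr h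
  refine ⟨hL.coloring, fun e => ?_⟩
  change L (e : G.edgeSet) = p e
  rw [← hKe e]
  obtain ⟨⟨s, hs⟩, he⟩ := e
  induction s with
  | _ x y => exact L_near ⟨⟨s(x, y), hs⟩, he⟩ x y ⟨x, by simp, Or.inl rfl⟩ hs

end Gluing

/-! ### From darts to edges, and the parity obstruction -/

section Darts

variable {V α : Type*} {Q : Quad V} {G : SimpleGraph V}

theorem exists_edgeColor [Nonempty α] {C : V → Dir → α} (hC : Q.Proper C) :
    ∃ K : Sym2 V → α, ∀ p d, K s(p, Q.step d p) = C p d := by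
  classical
  let K : Sym2 V → α := fun s =>
    if h : ∃ pd : V × Dir, s = s(pd.1, Q.step pd.2 pd.1) then C h.choose.1 h.choose.2
    else Classical.arbitrary α
  refine ⟨K, fun p d => ?_⟩
  have h : ∃ pd : V × Dir, s(p, Q.step d p) = s(pd.1, Q.step pd.2 pd.1) := ⟨(p, d), rfl⟩
  simp only [K, dif_pos h]
  have hs := h.choose_spec
  generalize h.choose = pd at hs
  rcases Sym2.eq_iff.1 hs with ⟨h1, h2⟩ | ⟨h1, h2⟩
  · rw [← h1] at h2 ⊢
    rw [Q.step_inj _ _ _ h2]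
  · obtain ⟨q, e⟩ := pd
    simp only at h1 h2 ⊢
    subst h2
    rw [Q.step_inj _ e (op d) (h1.symm.trans (Q.step_op d p).symm), hC.1]

theorem edgeProper_of_proper (hG : ∀ p q, G.Adj p q ↔ ∃ d, Q.step d p = q)
    {C : V → Dir → α} (hC : Q.Proper C) {K : Sym2 V → α}
    (hK : ∀ p d, K s(p, Q.step d p) = C p d) : EdgeProper G K := by
  intro p q r hq hr h
  obtain ⟨d, rfl⟩ := (hG p q).1 hq
  obtain ⟨d', rfl⟩ := (hG p r).1 hr
  rw [hK, hK] at h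
  rw [hC.2 p d d' h]

theorem near_iff_ball (hG : ∀ p q, G.Adj p q ↔ ∃ d, Q.step d p = q) {u x : V} {d₀ : Dir} :
    Near G s(u, Q.step d₀ u) x ↔ Q.Ball u d₀ x := by
  simp only [Near, Quad.Ball, Sym2.mem_iff, hG, exists_eq_or_imp, exists_eq_left, eq_comm (a := x)]
  tauto

/-- Four colors at a vertex of degree 4 all occur, so moving along the edge of color 0 is an
involution without fixed points. -/
theorem card_even_of_proper [Fintype V] [DecidableEq V] {C : V → Dir → Fin 4} (hC : Q.Proper C) :
    Even (Fintype.card V) := by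
  have hsurj : ∀ p, ∃ d, C p d = 0 := by
    intro p
    have : Function.Bijective (C p) := (Fintype.bijective_iff_injective_and_card _).2
      ⟨fun d d' h => hC.2 p d d' h, by simp⟩
    exact this.2 0
  choose m hm using hsurj
  have hmate : ∀ p, m (Q.step (m p) p) = op (m p) := fun p =>
    hC.2 _ _ _ (by rw [hm, hC.1, hm])
  have hsum : ∑ _p : V, (1 : ZMod 2) = 0 :=
    Finset.sum_involution (fun p _ => Q.step (m p) p) (fun _ _ => by decide)
      (fun p _ _ => Q.step_ne _ p) (fun _ _ => Finset.mem_univ _)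
      (fun p _ => by rw [hmate, Q.step_op])
  rw [Finset.sum_const, Finset.card_univ, nsmul_one] at hsum
  exact (ZMod.natCast_eq_zero_iff_even).1 hsum

end Darts

/-! ### The product of cycles as a torus, and the conclusion -/

variable {k l : ℕ}

theorem torus_adj (hk : 1 ≤ k) (hl : 1 ≤ l) (p q : Fin (2 * k + 1) × Fin (2 * l + 1)) :
    (SimpleGraph.boxProd (SimpleGraph.cycleGraph (2 * k + 1))
      (SimpleGraph.cycleGraph (2 * l + 1))).Adj p q ↔ ∃ d, (torus hk hl).step d p = q := by
  have cyc : ∀ {n : ℕ}, 1 ≤ n → ∀ a b : Fin (2 * n + 1),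
      (SimpleGraph.cycleGraph (2 * n + 1)).Adj a b ↔ a + 1 = b ∨ a - 1 = b := by
    intro n hn a b
    rw [SimpleGraph.cycleGraph_eq_circulantGraph, SimpleGraph.circulantGraph_adj]
    simp only [Set.mem_singleton_iff]
    constructor
    · rintro ⟨-, h | h⟩
      · exact Or.inr (by rw [← h]; simp)
      · exact Or.inl (by rw [← h]; simp)
    · rintro (rfl | rfl)
      · exact ⟨(one_add_ne hn a).symm, Or.inr (by simp)⟩
      · exact ⟨(sub_one_ne hn a).symm, Or.inl (by simp)⟩
  obtain ⟨a, b⟩ := p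
  obtain ⟨a', b'⟩ := q
  rw [SimpleGraph.boxProd_adj, cyc hk, cyc hl]
  constructor
  · rintro (⟨h | h, h'⟩ | ⟨h | h, h'⟩)
    · exact ⟨(false, true), Prod.ext h h'⟩
    · exact ⟨(false, false), Prod.ext h h'⟩
    · exact ⟨(true, true), Prod.ext h' h⟩
    · exact ⟨(true, false), Prod.ext h' h⟩
  · rintro ⟨⟨_ | _, _ | _⟩, h⟩ <;> obtain ⟨h1, h2⟩ := Prod.ext_iff.1 h
    · exact Or.inl ⟨Or.inr h1, h2⟩
    · exact Or.inl ⟨Or.inl h1, h2⟩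
    · exact Or.inr ⟨Or.inr h2, h1⟩
    · exact Or.inr ⟨Or.inl h2, h1⟩

theorem exists_axis {V : Type*} {Q : Quad V} {G : SimpleGraph V}
    (hG : ∀ p q, G.Adj p q ↔ ∃ d, Q.step d p = q) (e : G.edgeSet) :
    ∃ u axis, (e : Sym2 V) = s(u, Q.step (axis, true) u) := by
  obtain ⟨s, hs⟩ := e
  induction s with
  | _ p q =>
    obtain ⟨⟨axis, _ | _⟩, rfl⟩ := (hG p q).1 hs
    · refine ⟨Q.step (axis, false) p, axis, ?_⟩
      have : Q.step (axis, true) (Q.step (axis, false) p) = p := Q.step_op (axis, false) p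
      simp only [this, Sym2.eq_swap]
    · exact ⟨p, axis, rfl⟩

end OddTorus

open OddTorus in
theorem theorem4 (k l : ℕ) (hk : 1 ≤ k) (hl : 1 ≤ l) :
    chromaticIndex
        (SimpleGraph.boxProd (SimpleGraph.cycleGraph (2 * k + 1))
          (SimpleGraph.cycleGraph (2 * l + 1))) = 5 ∧
      ∀ (E₀ : Set (SimpleGraph.boxProd (SimpleGraph.cycleGraph (2 * k + 1))
            (SimpleGraph.cycleGraph (2 * l + 1))).edgeSet)
        (p : E₀ → Fin 5),
        (∀ e ∈ E₀, ∀ f ∈ E₀, e ≠ f →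
          3 ≤ edgeDist (SimpleGraph.boxProd (SimpleGraph.cycleGraph (2 * k + 1))
            (SimpleGraph.cycleGraph (2 * l + 1))) e f) →
        ExtendsToProper (SimpleGraph.boxProd (SimpleGraph.cycleGraph (2 * k + 1))
          (SimpleGraph.cycleGraph (2 * l + 1))) E₀ p := by
  have hG := torus_adj hk hl
  set G := SimpleGraph.boxProd (SimpleGraph.cycleGraph (2 * k + 1))
    (SimpleGraph.cycleGraph (2 * l + 1)) with hGdef
  clear_value G
  -- Either axis would do; this coloring gives the upper bound 5 and settles empty `E₀`.
  obtain ⟨K₁, hK₁⟩ := exists_edgeColor (proper_baseColor hk hl false)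
  have hK₁' := edgeProper_of_proper hG (proper_baseColor hk hl false) hK₁
  refine ⟨?_, fun E₀ p hE => ?_⟩
  · refine (SimpleGraph.chromaticNumber_eq_iff_colorable_not_colorable (n := 4)).2
      ⟨⟨hK₁'.coloring⟩, ?_⟩
    rintro ⟨c⟩
    have hadj : ∀ q d, G.Adj q ((torus hk hl).step d q) := fun q d => (hG _ _).2 ⟨d, rfl⟩
    have hproper : (torus hk hl).Proper fun q d =>
        c ⟨s(q, (torus hk hl).step d q), hadj q d⟩ := by
      refine ⟨fun q d => ?_, fun q d d' h => ?_⟩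
      · refine congrArg c (Subtype.ext ?_)
        simp only [Quad.step_op, Sym2.eq_swap]
      · by_contra hne
        refine c.valid (SimpleGraph.lineGraph_adj_iff_exists.2 ⟨fun h' => hne ?_, q, ?_, ?_⟩) h
        · exact (torus hk hl).step_inj q d d' (Sym2.congr_right.1 (Subtype.ext_iff.1 h'))
        · simp
        · simp
    have := card_even_of_proper hproper
    rw [Fintype.card_prod, Fintype.card_fin, Fintype.card_fin, Nat.even_mul] at this
    rcases this with ⟨m, h⟩ | ⟨m, h⟩ <;> omega
  · have hsep : ∀ e ∈ E₀, ∀ f ∈ E₀, e ≠ f → ∀ x, Near G e x → ¬ Near G f x :=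
      fun e he f hf hne x h1 h2 =>
        absurd ((hE e he f hf hne).trans (edgeDist_le_two h1 h2)) (by decide)
    rcases E₀.eq_empty_or_nonempty with rfl | ⟨e₀, he₀⟩
    · exact extendsToProper_of_local hK₁' hsep fun e => e.2.elim
    obtain ⟨u₀, axis₀, hu₀⟩ := exists_axis hG e₀
    obtain ⟨C, hC, hC₀, hrec⟩ := exists_recolorable hk hl u₀ axis₀ (p ⟨e₀, he₀⟩)
    obtain ⟨K, hK⟩ := exists_edgeColor hC
    have hK' := edgeProper_of_proper hG hC hK
    refine extendsToProper_of_local hK' hsep fun e => ?_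
    by_cases he : e = ⟨e₀, he₀⟩
    · subst he
      exact ⟨K, hK', by rw [hu₀, hK, hC₀], fun _ _ _ _ => rfl⟩
    · obtain ⟨u, axis, hu⟩ := exists_axis hG (e : G.edgeSet)
      have hne : (e : G.edgeSet) ≠ e₀ := fun h => he (Subtype.ext h)
      obtain ⟨C', h1, h2, h3⟩ := hrec u axis (fun x hx => by
        have := hsep e e.2 e₀ he₀ hne x
        rw [hu, hu₀, near_iff_ball hG, near_iff_ball hG] at this
        exact this hx) (p e)
      obtain ⟨K', hK''⟩ := exists_edgeColor h1
      refine ⟨K', edgeProper_of_proper hG h1 hK'', by rw [hu, hK'', h2], fun q r hqr hfar => ?_⟩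
      obtain ⟨d, rfl⟩ := (hG q r).1 hqr
      rw [hK'', hK]
      by_contra hne'
      rw [hu, near_iff_ball hG, near_iff_ball hG] at hfar
      exact hfar (h3 q d hne')
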